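/- For an integer $n$ and a real number $x$ let $J_n(x)=\frac1\pi\int_0^\pi\cos(n\theta-x\sin\theta)\,d\theta$ be the Bessel function of the first kind, and for real $x$ let $\mathrm{Ai}(x)=\frac1\pi\lim_{R\to\infty}\int_0^R\cos\left(\frac{t^3}{3}+xt\right)dt$ be the Airy function (the limit exists for every real $x$). For real $A>0$ and integers $\nu,\lambda$, let $$K_A(\nu,\lambda)=\sum_{r=0}^{\infty}J_{\nu+r}(A)\,J_{\lambda+r}(A)$$ be the discrete Bessel kernel (the series converges absolutely). Set $\kappa_A=(A/2)^{1/3}$, and for $s,t\in\mathbb R$ set $$\nu_A(s)=\lfloor A+s\kappa_A\rfloor,\qquad \widehat K_A(s,t)=\kappa_A\,K_A\big(\nu_A(s),\nu_A(t)\big).$$ Then, as $A\to\infty$ through the real numbers, $$\widehat K_A(s,t)\longrightarrow K_{\mathrm{Ai}}(s,t):=\int_0^\infty \mathrm{Ai}(s+u)\,\mathrm{Ai}(t+u)\,du$$ locally uniformly in $(s,t)\in\mathbb R^2$, where the integral defining $K_{\mathrm{Ai}}(s,t)$ converges absolutely for all $s,t\in\mathbb R$. -/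

import Mathlib

open Real Set Filter Topology MeasureTheory

noncomputable section

/-- The Bessel function of the first kind `J_n(x)` of integer order `n`, by Bessel's integral.
Equivalently, `J_n(x)` is the `n`-th Fourier coefficient of `θ ↦ exp (i x sin θ)`. -/
def besselJ (n : ℤ) (x : ℝ) : ℝ :=
  (1 / π) * ∫ θ in (0 : ℝ)..π, Real.cos ((n : ℝ) * θ - x * Real.sin θ)

/-- The truncated Airy integral `(1/π) ∫_0^R cos (t³/3 + x t) dt`. -/
def airyTrunc (x R : ℝ) : ℝ :=
  (1 / π) * ∫ t in (0 : ℝ)..R, Real.cos (t ^ 3 / 3 + x * t)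

/-- The Airy function `Ai(x) = (1/π) ∫_0^∞ cos (t³/3 + x t) dt`, as an improper Riemann integral
(the integral is only conditionally convergent). -/
def airyAi (x : ℝ) : ℝ :=
  limUnder atTop (airyTrunc x)

/-- The discrete Bessel kernel `K_A(ν, λ) = ∑_{r ≥ 0} J_{ν+r}(A) J_{λ+r}(A)`. -/
def discreteBesselKernel (A : ℝ) (ν l : ℤ) : ℝ :=
  ∑' r : ℕ, besselJ (ν + r) A * besselJ (l + r) A

/-- The edge scale `κ_A = (A/2)^{1/3}`. -/
def edgeScale (A : ℝ) : ℝ :=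
  (A / 2) ^ (1 / 3 : ℝ)

/-- The edge index `ν_A(s) = ⌊A + s κ_A⌋`. -/
def edgeIndex (A s : ℝ) : ℤ :=
  ⌊A + s * edgeScale A⌋

/-- The rescaled kernel `κ_A K_A(ν_A(s), ν_A(t))`. -/
def rescaledKernel (A s t : ℝ) : ℝ :=
  edgeScale A * discreteBesselKernel A (edgeIndex A s) (edgeIndex A t)

/-- The Airy kernel `K_Ai(s, t) = ∫_0^∞ Ai(s+u) Ai(t+u) du`. -/
def airyKernel (s t : ℝ) : ℝ :=
  ∫ u in Ioi (0 : ℝ), airyAi (s + u) * airyAi (t + u)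

end

open intervalIntegral

/-! With `A = 2κ³` and `θ = t/κ`, Bessel's integral becomes `κ J_n(A) = edgeBessel κ y`, where `y =
(n - A)/κ`: an oscillatory integral over `[0, πκ]` whose phase tends pointwise to `t³/3 + yt`. The
phase is convex with derivative at least `y + t²/4`, so the first-derivative test bounds the tails
uniformly in `κ`. Hence `edgeBessel κ y → Ai(y₀)` as `κ → ∞` and `y → y₀` jointly
(`tendsto_edgeBessel`), with a uniform `O(1/y)` bound (`exists_abs_edgeBessel_le`).

The rescaled kernel is exactly the integral over `u > 0` of a product of two such functions at nodes
near `s + u` and `t + u` (`rescaledKernel_eq_integral`). Dominated convergence with majorant `C/(1 +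
u)²` gives the limit along moving `(s, t)`, which amounts to local uniformity. -/

/-- No continuity of `f` is assumed: for `y` near `x`, `f y` is a limit of values `F j y` that are
already close to `f x`. -/
lemma tendstoLocallyUniformly_of_tendsto_prod {ι X E : Type*} [TopologicalSpace X]
    [PseudoMetricSpace E] {p : Filter ι} [p.NeBot] {F : ι → X → E} {f : X → E}
    (h : ∀ x, Tendsto (fun q : ι × X => F q.1 q.2) (p ×ˢ 𝓝 x) (𝓝 (f x))) :
    TendstoLocallyUniformly F f p := by
  rw [Metric.tendstoLocallyUniformly_iff]
  intro ε hε x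
  have hx := (Metric.tendsto_nhds.1 (h x)) (ε / 2) (half_pos hε)
  obtain ⟨P, hP, Q, hQ, hPQ⟩ := eventually_prod_iff.1 hx
  refine ⟨{y | Q y}, hQ, ?_⟩
  filter_upwards [hP] with i hi y hy
  have hlim : Tendsto (fun j => F j y) p (𝓝 (f y)) :=
    (h y).comp (tendsto_id.prodMk (tendsto_const_nhds (x := y)))
  have h1 : dist (f y) (f x) ≤ ε / 2 :=
    le_of_tendsto (hlim.dist tendsto_const_nhds)
      (hP.mono fun j hj => (hPQ hj hy).le)
  have h2 := hPQ hi hy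
  calc dist (f y) (F i y) ≤ dist (f y) (f x) + dist (F i y) (f x) := dist_triangle_right _ _ _
    _ < ε := by linarith

/-- The first-derivative test for oscillatory integrals with a convex phase. -/
lemma abs_integral_cos_le {φ φ' φ'' : ℝ → ℝ} {a b m : ℝ} (hab : a ≤ b) (hm : 0 < m)
    (hφ : ∀ x, HasDerivAt φ (φ' x) x) (hφ' : ∀ x, HasDerivAt φ' (φ'' x) x)
    (hc : Continuous φ'') (hpos : ∀ x ∈ Icc a b, 0 ≤ φ'' x) (hle : ∀ x ∈ Icc a b, m ≤ φ' x) :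
    |∫ x in a..b, Real.cos (φ x)| ≤ 2 / m := by
  have hcφ : Continuous φ := continuous_iff_continuousAt.2 fun x => (hφ x).continuousAt
  have hcφ' : Continuous φ' := continuous_iff_continuousAt.2 fun x => (hφ' x).continuousAt
  have hne : ∀ x ∈ Icc a b, φ' x ≠ 0 := fun x hx => (hm.trans_le (hle x hx)).ne'
  have hcont : ContinuousOn (fun x => φ'' x / φ' x ^ 2) (uIcc a b) := by
    rw [uIcc_of_le hab]
    exact hc.continuousOn.div (hcφ'.pow 2).continuousOn fun x hx => pow_ne_zero 2 (hne x hx)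
  have hcont2 : ContinuousOn (fun x => Real.sin (φ x) * (φ'' x / φ' x ^ 2)) (uIcc a b) :=
    (Real.continuous_sin.comp hcφ).continuousOn.mul hcont
  have hI1 : ∫ x in a..b, φ'' x / φ' x ^ 2 = -(φ' b)⁻¹ - -(φ' a)⁻¹ := by
    refine integral_eq_sub_of_hasDerivAt (f := fun x => -(φ' x)⁻¹) (fun x hx => ?_)
      hcont.intervalIntegrable
    rw [uIcc_of_le hab] at hx
    exact ((hφ' x).fun_inv (hne x hx)).fun_neg.congr_deriv (by ring)
  -- Integration by parts. Since `φ'' ≥ 0`, the remaining integral is at most `1/φ'(a) - 1/φ'(b)`;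
  -- with the boundary terms the total is at most `2/φ'(a)`.
  have hI2 : ∫ x in a..b, (Real.cos (φ x) - Real.sin (φ x) * (φ'' x / φ' x ^ 2)) =
      Real.sin (φ b) / φ' b - Real.sin (φ a) / φ' a := by
    refine integral_eq_sub_of_hasDerivAt (f := fun x => Real.sin (φ x) / φ' x) (fun x hx => ?_)
      (((Real.continuous_cos.comp hcφ).continuousOn.sub hcont2).intervalIntegrable)
    rw [uIcc_of_le hab] at hx
    have := hne x hx
    exact (((hφ x).sin).fun_div (hφ' x) this).congr_deriv (by field_simp)
  rw [integral_sub (f := fun x => Real.cos (φ x))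
    ((Real.continuous_cos.comp hcφ).intervalIntegrable _ _) hcont2.intervalIntegrable] at hI2
  have hI3 : |∫ x in a..b, Real.sin (φ x) * (φ'' x / φ' x ^ 2)| ≤ (φ' a)⁻¹ - (φ' b)⁻¹ := by
    have : (φ' a)⁻¹ - (φ' b)⁻¹ = ∫ x in a..b, φ'' x / φ' x ^ 2 := by rw [hI1]; ring
    rw [this, ← Real.norm_eq_abs]
    refine norm_integral_le_of_norm_le hab (ae_of_all _ fun x hx => ?_) hcont.intervalIntegrable
    have h0 : 0 ≤ φ'' x / φ' x ^ 2 := div_nonneg (hpos x (Ioc_subset_Icc_self hx)) (sq_nonneg _)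
    rw [norm_mul, Real.norm_eq_abs, Real.norm_eq_abs, abs_of_nonneg h0]
    exact mul_le_of_le_one_left h0 (Real.abs_sin_le_one _)
  have hbd : ∀ x ∈ Icc a b, |Real.sin (φ x) / φ' x| ≤ (φ' x)⁻¹ := fun x hx => by
    have h0 : 0 < φ' x := hm.trans_le (hle x hx)
    rw [abs_div, abs_of_pos h0, div_eq_mul_inv]
    exact mul_le_of_le_one_left (inv_nonneg.2 h0.le) (Real.abs_sin_le_one _)
  have ha := hbd a (left_mem_Icc.2 hab)
  have hb := hbd b (right_mem_Icc.2 hab)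
  have hma : (φ' a)⁻¹ ≤ m⁻¹ := inv_anti₀ hm (hle a (left_mem_Icc.2 hab))
  rw [div_eq_mul_inv]
  rw [abs_le] at *
  constructor <;> linarith

/-! ### Edge-scaled Bessel functions: bounds uniform in `κ` -/

/-- The phase of Bessel's integral after the edge scaling. -/
noncomputable def edgePhase (κ y t : ℝ) : ℝ :=
  y * t + 2 * κ ^ 3 * (t / κ - Real.sin (t / κ))

/-- The truncation at `T` of the edge-scaled Bessel integral. -/
noncomputable def edgeTrunc (κ y T : ℝ) : ℝ :=
  (1 / π) * ∫ t in (0 : ℝ)..T, Real.cos (edgePhase κ y t)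

/-- The edge-scaled Bessel function, with the index replaced by a continuous variable. -/
noncomputable def edgeBessel (κ y : ℝ) : ℝ :=
  edgeTrunc κ y (π * κ)

lemma continuous_edgePhase (κ : ℝ) : Continuous fun p : ℝ × ℝ => edgePhase κ p.1 p.2 := by
  unfold edgePhase
  fun_prop

lemma continuous_edgeBessel (κ : ℝ) : Continuous (edgeBessel κ) := by
  unfold edgeBessel edgeTrunc
  refine continuous_const.mul ?_
  exact continuous_parametric_intervalIntegral_of_continuous'
    (f := fun y t => Real.cos (edgePhase κ y t))
    (Real.continuous_cos.comp (continuous_edgePhase κ)) _ _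

lemma hasDerivAt_edgePhase (κ y t : ℝ) :
    HasDerivAt (edgePhase κ y) (y + 2 * κ ^ 2 * (1 - Real.cos (t / κ))) t := by
  have h1 : HasDerivAt (fun t : ℝ => t / κ) (1 / κ) t := (hasDerivAt_id t).div_const κ
  refine (((hasDerivAt_id t).const_mul y).fun_add
    ((h1.fun_sub h1.sin).const_mul (2 * κ ^ 3))).congr_deriv ?_
  field_simp

lemma hasDerivAt_deriv_edgePhase {κ : ℝ} (hκ : 0 < κ) (y t : ℝ) :
    HasDerivAt (fun t => y + 2 * κ ^ 2 * (1 - Real.cos (t / κ)))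
      (2 * κ * Real.sin (t / κ)) t := by
  have h1 : HasDerivAt (fun t : ℝ => t / κ) (1 / κ) t := (hasDerivAt_id t).div_const κ
  refine (((h1.cos.const_sub 1).const_mul (2 * κ ^ 2)).const_add y).congr_deriv ?_
  field_simp

lemma abs_one_div_pi_mul_le {x m : ℝ} (h : |x| ≤ 2 / m) : |1 / π * x| ≤ 1 / m := by
  rw [abs_mul, abs_of_pos (by positivity : 0 < 1 / π)]
  have hπ : 1 / π ≤ 1 / 2 := one_div_le_one_div_of_le two_pos Real.two_le_pi
  calc 1 / π * |x| ≤ 1 / 2 * (2 / m) := by gcongr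
    _ = 1 / m := by ring

/-- On `[T, πκ]` the phase is convex because `sin ≥ 0` on `[0, π]`, and `1 - cos x ≥ 2x²/π² ≥ x²/8`
there gives slope at least `y + T²/4`. -/
lemma abs_edgeBessel_sub_edgeTrunc_le {κ y T : ℝ} (hκ : 0 < κ) (hT : 0 ≤ T) (hTκ : T ≤ π * κ)
    (hy : 0 < y + T ^ 2 / 4) :
    |edgeBessel κ y - edgeTrunc κ y T| ≤ 1 / (y + T ^ 2 / 4) := by
  have hcont : Continuous fun t => Real.cos (edgePhase κ y t) :=
    Real.continuous_cos.comp ((continuous_edgePhase κ).comp (Continuous.prodMk_right y))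
  unfold edgeBessel edgeTrunc
  rw [← mul_sub, integral_interval_sub_left (hcont.intervalIntegrable _ _)
    (hcont.intervalIntegrable _ _)]
  refine abs_one_div_pi_mul_le ?_
  refine abs_integral_cos_le hTκ hy (hasDerivAt_edgePhase κ y)
    (hasDerivAt_deriv_edgePhase hκ y) (by fun_prop) (fun t ht => ?_) fun t ht => ?_
  · have h0 : 0 ≤ t := hT.trans ht.1
    have := Real.sin_nonneg_of_nonneg_of_le_pi (div_nonneg h0 hκ.le) ((div_le_iff₀ hκ).2 ht.2)
    positivity
  · have h0 : 0 ≤ t := hT.trans ht.1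
    have h1 : |t / κ| ≤ π := by
      rw [abs_of_nonneg (div_nonneg h0 hκ.le)]
      exact (div_le_iff₀ hκ).2 ht.2
    have h2 := Real.cos_le_one_sub_mul_cos_sq h1
    have h3 : (1 : ℝ) / 8 ≤ 2 / π ^ 2 := by
      rw [div_le_div_iff₀ (by norm_num) (by positivity)]
      nlinarith [Real.pi_le_four, Real.pi_pos]
    have h4 : 1 / 8 * (t / κ) ^ 2 ≤ 1 - Real.cos (t / κ) := by
      have := mul_le_mul_of_nonneg_right h3 (sq_nonneg (t / κ))
      linarith
    have h5 : 2 * κ ^ 2 * (1 / 8 * (t / κ) ^ 2) = t ^ 2 / 4 := by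
      field_simp
      ring
    have h6 := mul_le_mul_of_nonneg_left h4 (by positivity : 0 ≤ 2 * κ ^ 2)
    have h7 : T ^ 2 ≤ t ^ 2 := pow_le_pow_left₀ hT ht.1 2
    linarith

lemma abs_edgeTrunc_le (κ y : ℝ) {T : ℝ} (hT : 0 ≤ T) : |edgeTrunc κ y T| ≤ T := by
  unfold edgeTrunc
  have h : |∫ t in (0 : ℝ)..T, Real.cos (edgePhase κ y t)| ≤ 1 * |T - 0| := by
    rw [← Real.norm_eq_abs]
    exact norm_integral_le_of_norm_le_const fun t _ => Real.abs_cos_le_one _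
  rw [sub_zero, abs_of_nonneg hT, one_mul] at h
  rw [abs_mul, abs_of_pos (by positivity : 0 < 1 / π)]
  have hπ : 1 / π ≤ 1 := by
    rw [div_le_one Real.pi_pos]
    linarith [Real.two_le_pi]
  exact (mul_le_mul hπ h (abs_nonneg _) zero_le_one).trans_eq (one_mul T)

lemma abs_edgeBessel_le_inv {κ y : ℝ} (hκ : 0 < κ) (hy : 0 < y) : |edgeBessel κ y| ≤ 1 / y := by
  have := abs_edgeBessel_sub_edgeTrunc_le (y := y) hκ le_rfl (by positivity) (by simpa using hy)
  simpa [edgeTrunc] using this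

lemma exists_abs_edgeBessel_le {M : ℝ} (hM : 0 ≤ M) :
    ∃ C, 0 ≤ C ∧ ∀ κ, 0 < κ → ∀ y, -M ≤ y → |edgeBessel κ y| ≤ C / (1 + M + y) := by
  -- Then `y + T²/4 = y + (M + 1)² ≥ 1` for all `y ≥ -M`, so the tail past `T` is at most `1`.
  set T : ℝ := 2 * (M + 1) with hTdef
  have hT : 0 ≤ T := by positivity
  refine ⟨(T + 1) * (2 + M), by positivity, fun κ hκ y hy => ?_⟩
  have hden : 0 < 1 + M + y := by linarith
  rw [le_div_iff₀ hden]
  rcases le_total y 1 with h1 | h1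
  · have hB : |edgeBessel κ y| ≤ T + 1 := by
      rcases le_total T (π * κ) with h | h
      · have hpos : 1 ≤ y + T ^ 2 / 4 := by rw [hTdef]; nlinarith
        have h2 := abs_edgeBessel_sub_edgeTrunc_le hκ hT h (zero_lt_one.trans_le hpos)
        have h3 := abs_edgeTrunc_le κ y hT
        have h4 : 1 / (y + T ^ 2 / 4) ≤ 1 := by
          rw [div_le_one (by linarith)]
          exact hpos
        have h5 := abs_sub_abs_le_abs_sub (edgeBessel κ y) (edgeTrunc κ y T)
        linarith
      · have := abs_edgeTrunc_le κ y (by positivity : 0 ≤ π * κ)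
        unfold edgeBessel
        linarith
    exact mul_le_mul hB (by linarith) hden.le (by positivity)
  · have h2 := abs_edgeBessel_le_inv hκ (zero_lt_one.trans_le h1)
    rw [le_div_iff₀ (by linarith)] at h2
    have h3 : 1 + M + y ≤ (2 + M) * y := by nlinarith
    calc |edgeBessel κ y| * (1 + M + y) ≤ |edgeBessel κ y| * ((2 + M) * y) := by gcongr
      _ = |edgeBessel κ y| * y * (2 + M) := by ring
      _ ≤ 1 * (2 + M) := by gcongr
      _ ≤ _ := by gcongr; linarith

/-! ### Convergence of the Airy integral -/

lemma abs_airyTrunc_sub_le {x R S : ℝ} (hR : 0 ≤ R) (hRS : R ≤ S) (hx : 0 < x + R ^ 2) :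
    |airyTrunc x S - airyTrunc x R| ≤ 1 / (x + R ^ 2) := by
  have hcont : Continuous fun t : ℝ => Real.cos (t ^ 3 / 3 + x * t) := by fun_prop
  unfold airyTrunc
  rw [← mul_sub, integral_interval_sub_left (hcont.intervalIntegrable _ _)
    (hcont.intervalIntegrable _ _)]
  refine abs_one_div_pi_mul_le ?_
  refine abs_integral_cos_le (φ' := fun t => x + t ^ 2) (φ'' := fun t => 2 * t) hRS hx
    (fun t => ?_) (fun t => ?_) (by fun_prop)
    (fun t ht => by have := hR.trans ht.1; positivity) fun t ht => ?_
  · refine (((hasDerivAt_pow 3 t).div_const 3).fun_add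
      ((hasDerivAt_id t).const_mul x)).congr_deriv ?_
    simp
    ring
  · refine ((hasDerivAt_pow 2 t).const_add x).congr_deriv ?_
    simp
  · have := pow_le_pow_left₀ hR ht.1 2
    simpa using this

lemma tendsto_one_div_add_sq_div (x : ℝ) {c : ℝ} (hc : 0 < c) :
    Tendsto (fun R : ℝ => 1 / (x + R ^ 2 / c)) atTop (𝓝 0) := by
  simp only [one_div]
  exact tendsto_inv_atTop_zero.comp
    (tendsto_atTop_add_const_left _ _
      ((tendsto_pow_atTop two_ne_zero).atTop_div_const hc))

lemma eventually_add_sq_div_pos (x : ℝ) {c : ℝ} (hc : 0 < c) :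
    ∀ᶠ R : ℝ in atTop, 0 < x + R ^ 2 / c :=
  (tendsto_atTop_add_const_left _ x
    ((tendsto_pow_atTop two_ne_zero).atTop_div_const hc)).eventually_gt_atTop 0

lemma tendsto_airyTrunc (x : ℝ) : Tendsto (airyTrunc x) atTop (𝓝 (airyAi x)) := by
  refine tendsto_nhds_limUnder (cauchySeq_tendsto_of_complete ?_)
  rw [Metric.cauchySeq_iff']
  intro ε hε
  obtain ⟨R, hR0, hRpos, hRε⟩ := ((eventually_ge_atTop (0 : ℝ)).and
    ((eventually_add_sq_div_pos x one_pos).and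
      ((tendsto_one_div_add_sq_div x one_pos).eventually_lt_const hε))).exists
  rw [div_one] at hRpos hRε
  exact ⟨R, fun S hS => (abs_airyTrunc_sub_le hR0 hS hRpos).trans_lt hRε⟩

lemma abs_airyAi_sub_airyTrunc_le {x R : ℝ} (hR : 0 ≤ R) (hx : 0 < x + R ^ 2) :
    |airyAi x - airyTrunc x R| ≤ 1 / (x + R ^ 2) :=
  le_of_tendsto ((tendsto_airyTrunc x).sub_const _).abs
    ((eventually_ge_atTop R).mono fun _ hS => abs_airyTrunc_sub_le hR hS hx)

/-! ### Convergence of edge-scaled Bessel functions to `Ai` -/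

lemma tendsto_edgePhase (y₀ t : ℝ) :
    Tendsto (fun q : ℝ × ℝ => edgePhase q.1 q.2 t) (atTop ×ˢ 𝓝 y₀) (𝓝 (t ^ 3 / 3 + y₀ * t)) := by
  have h1 : Tendsto (fun κ : ℝ => 2 * κ ^ 3 * (t / κ - Real.sin (t / κ))) atTop
      (𝓝 (t ^ 3 / 3)) := by
    rw [tendsto_iff_norm_sub_tendsto_zero]
    refine squeeze_zero' (Eventually.of_forall fun _ => norm_nonneg _) ?_
      ((tendsto_const_nhds (x := |t| ^ 4)).div_atTop tendsto_id)
    filter_upwards [eventually_gt_atTop 0, eventually_ge_atTop |t|] with κ hκ hκt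
    have hle : |t / κ| ≤ 1 := by
      rw [abs_div, abs_of_pos hκ]
      exact (div_le_one hκ).2 hκt
    -- A Taylor error of order `(t/κ)⁴` suffices: after the factor `2κ³` it is `O(t⁴/κ)`.
    have h := Real.sin_bound hle
    have heq : 2 * κ ^ 3 * (t / κ - Real.sin (t / κ)) - t ^ 3 / 3 =
        -(2 * κ ^ 3) * (Real.sin (t / κ) - (t / κ - (t / κ) ^ 3 / 6)) := by
      field_simp
      ring
    rw [heq, norm_mul, norm_neg, Real.norm_eq_abs, Real.norm_eq_abs,
      abs_of_pos (by positivity : 0 < 2 * κ ^ 3)]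
    calc 2 * κ ^ 3 * |Real.sin (t / κ) - (t / κ - (t / κ) ^ 3 / 6)|
        ≤ 2 * κ ^ 3 * (|t / κ| ^ 4 / 100) := by
          gcongr
          exact h.trans
            (div_le_div_of_nonneg_right (pow_le_pow_of_le_one (abs_nonneg _) hle (by norm_num))
              (by norm_num))
      _ = (1 / 50) * (|t| ^ 4 / κ) := by
        rw [abs_div, abs_of_pos hκ]
        field_simp
        ring
      _ ≤ 1 * (|t| ^ 4 / κ) := by gcongr; norm_num
      _ = _ := one_mul _
  have h2 : Tendsto (fun q : ℝ × ℝ => q.2 * t) (atTop ×ˢ 𝓝 y₀) (𝓝 (y₀ * t)) :=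
    tendsto_snd.mul_const t
  simpa only [edgePhase, add_comm, Function.comp_def] using h2.add (h1.comp tendsto_fst)

lemma tendsto_edgeTrunc (y₀ T : ℝ) :
    Tendsto (fun q : ℝ × ℝ => edgeTrunc q.1 q.2 T) (atTop ×ˢ 𝓝 y₀) (𝓝 (airyTrunc y₀ T)) := by
  unfold edgeTrunc airyTrunc
  refine Tendsto.const_mul _ ?_
  refine tendsto_integral_filter_of_dominated_convergence (fun _ => 1)
    (Eventually.of_forall fun q => ?_)
    (Eventually.of_forall fun q => ae_of_all _ fun t _ => Real.abs_cos_le_one _)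
    intervalIntegrable_const
    (ae_of_all _ fun t _ => (Real.continuous_cos.tendsto _).comp (tendsto_edgePhase y₀ t))
  exact (Real.continuous_cos.comp ((continuous_edgePhase q.1).comp
    (Continuous.prodMk_right q.2))).aestronglyMeasurable

lemma tendsto_edgeBessel (y₀ : ℝ) :
    Tendsto (fun q : ℝ × ℝ => edgeBessel q.1 q.2) (atTop ×ˢ 𝓝 y₀) (𝓝 (airyAi y₀)) := by
  rw [Metric.tendsto_nhds]
  intro ε hε
  -- Using `y₀ - 1` makes one `T` serve every `y > y₀ - 1`; the Bessel tail, the Airy tail and the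
  -- truncated difference each cost `ε/3`.
  obtain ⟨T, hT0, hTpos, hTε⟩ := ((eventually_ge_atTop (0 : ℝ)).and
    ((eventually_add_sq_div_pos (y₀ - 1) four_pos).and
      ((tendsto_one_div_add_sq_div (y₀ - 1) four_pos).eventually_lt_const
        (by positivity : 0 < ε / 3)))).exists
  have hκ : ∀ᶠ q : ℝ × ℝ in atTop ×ˢ 𝓝 y₀, max 1 T ≤ q.1 :=
    tendsto_fst.eventually (eventually_ge_atTop _)
  have hy : ∀ᶠ q : ℝ × ℝ in atTop ×ˢ 𝓝 y₀, y₀ - 1 < q.2 :=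
    tendsto_snd.eventually (eventually_gt_nhds (by linarith))
  filter_upwards [hκ, hy,
    Metric.tendsto_nhds.1 (tendsto_edgeTrunc y₀ T) (ε / 3) (by positivity)] with q h1 h2 h3
  have hq : 1 ≤ q.1 := (le_max_left _ _).trans h1
  have hTq : T ≤ q.1 := (le_max_right _ _).trans h1
  have h4 := abs_edgeBessel_sub_edgeTrunc_le (y := q.2) (zero_lt_one.trans_le hq) hT0
    (by nlinarith [Real.two_le_pi]) (by linarith)
  have h5 : 1 / (q.2 + T ^ 2 / 4) ≤ 1 / (y₀ - 1 + T ^ 2 / 4) :=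
    one_div_le_one_div_of_le hTpos (by linarith)
  have h6 := abs_airyAi_sub_airyTrunc_le (x := y₀) hT0 (by nlinarith)
  have h7 : 1 / (y₀ + T ^ 2) ≤ 1 / (y₀ - 1 + T ^ 2 / 4) :=
    one_div_le_one_div_of_le hTpos (by nlinarith)
  rw [Real.dist_eq] at h3 ⊢
  rw [abs_le] at h4 h6
  rw [abs_lt] at h3 ⊢
  constructor <;> linarith [h3.1, h3.2, h4.1, h4.2, h6.1, h6.2]

lemma tendsto_edgeBessel_comp {ι : Type*} {l : Filter ι} {κ y : ι → ℝ} {y₀ : ℝ}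
    (hκ : Tendsto κ l atTop) (hy : Tendsto y l (𝓝 y₀)) :
    Tendsto (fun i => edgeBessel (κ i) (y i)) l (𝓝 (airyAi y₀)) :=
  Tendsto.comp (g := fun q : ℝ × ℝ => edgeBessel q.1 q.2) (f := fun i => (κ i, y i))
    (tendsto_edgeBessel y₀) (hκ.prodMk hy)

/-- `Ai` inherits continuity as a locally uniform limit of the continuous functions `edgeBessel κ`.
-/
lemma continuous_airyAi : Continuous airyAi :=
  (tendstoLocallyUniformly_of_tendsto_prod (p := atTop) (F := edgeBessel)
    tendsto_edgeBessel).continuous (Frequently.of_forall continuous_edgeBessel)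

lemma exists_abs_airyAi_le {M : ℝ} (hM : 0 ≤ M) :
    ∃ C, 0 ≤ C ∧ ∀ y, -M ≤ y → |airyAi y| ≤ C / (1 + M + y) := by
  obtain ⟨C, hC, h⟩ := exists_abs_edgeBessel_le hM
  exact ⟨C, hC, fun y hy => le_of_tendsto
    (tendsto_edgeBessel_comp tendsto_id (tendsto_const_nhds (x := y))).abs
    ((eventually_gt_atTop 0).mono fun κ hκ => h κ hκ y hy)⟩

lemma integrableOn_div_one_add_sq (C : ℝ) :
    IntegrableOn (fun u : ℝ => C / (1 + u) ^ 2) (Ioi 0) := by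
  have h : IntegrableOn (fun u : ℝ => (u + 1) ^ (-2 : ℝ)) (Ioi 0) :=
    integrableOn_add_rpow_Ioi_of_lt (by norm_num) (by norm_num)
  refine IntegrableOn.congr_fun (h.const_mul C) (fun u hu => ?_) measurableSet_Ioi
  have hu : (0 : ℝ) < u := hu
  have h1 : (0 : ℝ) ≤ u + 1 := by linarith
  rw [Real.rpow_neg h1, Real.rpow_two, add_comm, div_eq_mul_inv]

lemma norm_mul_le_div_one_add_sq {a b C C' u : ℝ} (hC : 0 ≤ C) (hu : 0 < u)
    (ha : |a| ≤ C / (1 + u)) (hb : |b| ≤ C' / (1 + u)) : ‖a * b‖ ≤ C * C' / (1 + u) ^ 2 := by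
  rw [norm_mul, Real.norm_eq_abs, Real.norm_eq_abs]
  calc |a| * |b| ≤ C / (1 + u) * (C' / (1 + u)) :=
        mul_le_mul ha hb (abs_nonneg _) (by positivity)
    _ = _ := by rw [div_mul_div_comm, sq]

lemma integrableOn_airyAi_mul_airyAi (s t : ℝ) :
    IntegrableOn (fun u : ℝ => airyAi (s + u) * airyAi (t + u)) (Ioi 0) := by
  obtain ⟨C, hC, h⟩ := exists_abs_airyAi_le (abs_nonneg s)
  obtain ⟨C', hC', h'⟩ := exists_abs_airyAi_le (abs_nonneg t)
  refine (integrableOn_div_one_add_sq (C * C')).mono' ?_ ?_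
  · exact ((continuous_airyAi.comp (by fun_prop)).mul
      (continuous_airyAi.comp (by fun_prop))).aestronglyMeasurable
  · refine (ae_restrict_iff' measurableSet_Ioi).2 (ae_of_all _ fun u hu => ?_)
    have hu : (0 : ℝ) < u := hu
    have hs := neg_abs_le s
    have ht := neg_abs_le t
    refine norm_mul_le_div_one_add_sq hC hu ((h _ (by linarith)).trans ?_)
      ((h' _ (by linarith)).trans ?_)
    all_goals exact div_le_div_of_nonneg_left ‹_› (by linarith) (by linarith)

/-! ### From Bessel functions to their edge scaling -/

lemma edgeScale_pos {A : ℝ} (hA : 0 < A) : 0 < edgeScale A :=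
  Real.rpow_pos_of_pos (by positivity) _

lemma two_mul_edgeScale_pow {A : ℝ} (hA : 0 < A) : 2 * edgeScale A ^ 3 = A := by
  rw [edgeScale, ← Real.rpow_natCast, ← Real.rpow_mul (by positivity)]
  norm_num
  ring

lemma tendsto_edgeScale : Tendsto edgeScale atTop atTop :=
  (tendsto_rpow_atTop (by norm_num)).comp (tendsto_id.atTop_div_const two_pos)

/-- Substitute `θ = t/κ` and split `nθ - A sin θ = (n - A)θ + A(θ - sin θ)` with `A = 2κ³`. -/
lemma edgeScale_mul_besselJ {A : ℝ} (hA : 0 < A) (n : ℤ) :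
    edgeScale A * besselJ n A = edgeBessel (edgeScale A) ((n - A) / edgeScale A) := by
  have hκ := edgeScale_pos hA
  have hA3 := two_mul_edgeScale_pow hA
  set κ := edgeScale A
  unfold besselJ edgeBessel edgeTrunc
  have h := integral_comp_div (a := 0) (b := π * κ)
    (fun θ => Real.cos ((n : ℝ) * θ - A * Real.sin θ)) hκ.ne'
  rw [zero_div, mul_div_cancel_right₀ _ hκ.ne', smul_eq_mul] at h
  rw [mul_left_comm, ← h]
  congr 1
  refine integral_congr fun t _ => ?_
  simp only [edgePhase, hA3]
  congr 1
  field_simp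
  ring

lemma summable_besselJ_mul_besselJ {A : ℝ} (hA : 0 < A) (ν l : ℤ) :
    Summable (fun r : ℕ => besselJ (ν + r) A * besselJ (l + r) A) := by
  have hκ := edgeScale_pos hA
  set κ := edgeScale A
  have hbd : ∀ n : ℤ, A < n → |besselJ n A| ≤ 1 / (n - A) := by
    intro n hn
    have hn' : 0 < (n : ℝ) - A := sub_pos.2 hn
    have h := abs_edgeBessel_le_inv hκ (div_pos hn' hκ)
    rw [← edgeScale_mul_besselJ hA, abs_mul, abs_of_pos hκ, one_div_div] at h
    rw [div_eq_mul_one_div] at h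
    exact le_of_mul_le_mul_left h hκ
  -- After a shift by `N` both indices exceed `A` by at least `r + 1`.
  obtain ⟨N, hN⟩ := exists_nat_gt (A + |(ν : ℝ)| + |(l : ℝ)| + 1)
  rw [← summable_nat_add_iff N]
  have hs : Summable fun r : ℕ => 1 / ((r : ℝ) + 1) ^ 2 := by
    have := (summable_nat_add_iff 1).2 (Real.summable_one_div_nat_pow.2 one_lt_two)
    simpa using this
  refine Summable.of_norm_bounded hs fun r => ?_
  have hν := neg_abs_le (ν : ℝ)
  have hl := neg_abs_le (l : ℝ)
  have hν' := abs_nonneg (ν : ℝ)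
  have hl' := abs_nonneg (l : ℝ)
  have hr : (0 : ℝ) ≤ r := r.cast_nonneg
  have key : ∀ m : ℤ, -(|(ν : ℝ)| + |(l : ℝ)|) ≤ m →
      |besselJ (m + (r + N : ℕ)) A| ≤ 1 / ((r : ℝ) + 1) := by
    intro m hm
    refine (hbd _ (by push_cast; linarith)).trans ?_
    refine one_div_le_one_div_of_le (by linarith) ?_
    push_cast
    linarith
  rw [norm_mul, Real.norm_eq_abs, Real.norm_eq_abs]
  calc _ ≤ 1 / ((r : ℝ) + 1) * (1 / ((r : ℝ) + 1)) :=
        mul_le_mul (key ν (by linarith)) (key l (by linarith)) (abs_nonneg _) (by positivity)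
    _ = _ := by rw [div_mul_div_comm, sq, one_mul]

/-! ### The kernel as an integral, and its limit -/

lemma integral_Ioi_comp_natFloor {g : ℕ → ℝ} (hg : Summable g)
    (hi : IntegrableOn (fun x : ℝ => g ⌊x⌋₊) (Ioi 0)) :
    ∫ x in Ioi (0 : ℝ), g ⌊x⌋₊ = ∑' r, g r := by
  have h1 := (intervalIntegral_tendsto_integral_Ioi 0 hi tendsto_id).comp
    (tendsto_natCast_atTop_atTop (R := ℝ))
  refine tendsto_nhds_unique h1 (hg.hasSum.tendsto_sum_nat.congr fun n => ?_)
  have hae : ∀ k : ℕ, ∀ x ∈ Ioo (k : ℝ) ((k + 1 : ℕ) : ℝ), g ⌊x⌋₊ = g k := fun k x hx => by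
    rw [(Nat.floor_eq_iff ((Nat.cast_nonneg k).trans hx.1.le)).2 ⟨hx.1.le, by simpa using hx.2⟩]
  have hint : ∀ k < n, IntervalIntegrable (fun x : ℝ => g ⌊x⌋₊) volume (k : ℝ) ((k + 1 : ℕ) : ℝ) :=
    fun k _ => (intervalIntegrable_iff_integrableOn_Ioc_of_le (by simp)).2
      (hi.mono_set fun x hx => (Nat.cast_nonneg k).trans_lt hx.1)
  have := sum_integral_adjacent_intervals hint
  simp only [Function.comp_apply, id]
  rw [Nat.cast_zero] at this
  rw [← this]
  refine Finset.sum_congr rfl fun k _ => ?_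
  rw [integral_of_le (by simp), integral_Ioc_eq_integral_Ioo,
    setIntegral_congr_fun measurableSet_Ioo (hae k)]
  simp

lemma edgeIndex_sub_div_bounds {A : ℝ} (hA : 0 < A) (s : ℝ) :
    s - 1 / edgeScale A ≤ (edgeIndex A s - A) / edgeScale A ∧
      (edgeIndex A s - A) / edgeScale A ≤ s := by
  have hκ := edgeScale_pos hA
  have h1 := Int.floor_le (A + s * edgeScale A)
  have h2 := Int.lt_floor_add_one (A + s * edgeScale A)
  constructor
  · rw [le_div_iff₀ hκ, sub_mul, one_div_mul_cancel hκ.ne']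
    unfold edgeIndex
    linarith
  · rw [div_le_iff₀ hκ]
    unfold edgeIndex
    linarith

/-- The scaled distance to the edge of the index which enters the Riemann sum at `u`. -/
noncomputable def edgeNode (A s u : ℝ) : ℝ :=
  (edgeIndex A s - A) / edgeScale A + ⌊edgeScale A * u⌋₊ / edgeScale A

lemma natFloor_mul_div_bounds {κ u : ℝ} (hκ : 0 < κ) (hu : 0 ≤ u) :
    u - 1 / κ ≤ ⌊κ * u⌋₊ / κ ∧ (⌊κ * u⌋₊ : ℝ) / κ ≤ u := by
  have h1 := Nat.floor_le (by positivity : 0 ≤ κ * u)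
  have h2 := Nat.lt_floor_add_one (κ * u)
  constructor
  · rw [le_div_iff₀ hκ, sub_mul, one_div_mul_cancel hκ.ne']
    linarith
  · rw [div_le_iff₀ hκ]
    linarith

lemma edgeNode_bounds {A u : ℝ} (hA : 0 < A) (hu : 0 ≤ u) (s : ℝ) :
    s + u - 2 * (1 / edgeScale A) ≤ edgeNode A s u ∧ edgeNode A s u ≤ s + u := by
  have h1 := edgeIndex_sub_div_bounds hA s
  have h2 := natFloor_mul_div_bounds (edgeScale_pos hA) hu
  unfold edgeNode
  constructor <;> linarith [h1.1, h1.2, h2.1, h2.2]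

lemma tendsto_edgeNode {ι : Type*} {l : Filter ι} {A s : ι → ℝ} {s₀ u : ℝ}
    (hA : Tendsto A l atTop) (hs : Tendsto s l (𝓝 s₀)) (hu : 0 ≤ u) :
    Tendsto (fun i => edgeNode (A i) (s i) u) l (𝓝 (s₀ + u)) := by
  have h0 : Tendsto (fun i => 1 / edgeScale (A i)) l (𝓝 0) := by
    simpa only [one_div, Function.comp_def] using
      (tendsto_inv_atTop_zero.comp tendsto_edgeScale).comp hA
  have hlow : Tendsto (fun i => s i + u - 2 * (1 / edgeScale (A i))) l (𝓝 (s₀ + u)) := by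
    simpa using (hs.add_const u).sub (h0.const_mul 2)
  refine tendsto_of_tendsto_of_tendsto_of_le_of_le' hlow (hs.add_const u) ?_ ?_
  · filter_upwards [hA.eventually_gt_atTop 0] with i hi using (edgeNode_bounds hi hu _).1
  · filter_upwards [hA.eventually_gt_atTop 0] with i hi using (edgeNode_bounds hi hu _).2

lemma measurable_edgeBessel_edgeNode (A s : ℝ) :
    Measurable fun u => edgeBessel (edgeScale A) (edgeNode A s u) := by
  unfold edgeNode
  exact (continuous_edgeBessel _).measurable.comp
    (((measurable_from_nat.comp (Nat.measurable_floor.comp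
      (measurable_const_mul (edgeScale A)))).div_const _).const_add _)

lemma edgeNode_eq {A : ℝ} (s u : ℝ) :
    edgeNode A s u = (((edgeIndex A s + ⌊edgeScale A * u⌋₊ : ℤ) : ℝ) - A) / edgeScale A := by
  unfold edgeNode
  push_cast
  ring

/-- The integrand is a step function with cells of length `1/κ` and values `κ² J J`, so integration
leaves the single factor `κ` of the rescaled kernel. -/
lemma rescaledKernel_eq_integral {A s t : ℝ} (hA : 0 < A)
    (hi : IntegrableOn (fun u => edgeBessel (edgeScale A) (edgeNode A s u) *
      edgeBessel (edgeScale A) (edgeNode A t u)) (Ioi 0)) :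
    rescaledKernel A s t = ∫ u in Ioi (0 : ℝ), edgeBessel (edgeScale A) (edgeNode A s u) *
      edgeBessel (edgeScale A) (edgeNode A t u) := by
  have hκ := edgeScale_pos hA
  set g : ℕ → ℝ := fun r => edgeScale A * edgeScale A *
    (besselJ (edgeIndex A s + r) A * besselJ (edgeIndex A t + r) A) with hg
  have hgs : Summable g := (summable_besselJ_mul_besselJ hA _ _).mul_left _
  have heq : (fun u => edgeBessel (edgeScale A) (edgeNode A s u) *
      edgeBessel (edgeScale A) (edgeNode A t u)) = fun u => g ⌊edgeScale A * u⌋₊ := by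
    funext u
    rw [edgeNode_eq, edgeNode_eq, ← edgeScale_mul_besselJ hA, ← edgeScale_mul_besselJ hA, hg]
    ring
  rw [heq] at hi ⊢
  have hi' : IntegrableOn (fun x : ℝ => g ⌊x⌋₊) (Ioi 0) := by
    have := (integrableOn_Ioi_comp_mul_left_iff (fun x : ℝ => g ⌊x⌋₊) 0 hκ).1 hi
    simpa using this
  rw [integral_comp_mul_left_Ioi (fun x : ℝ => g ⌊x⌋₊) 0 hκ, mul_zero,
    integral_Ioi_comp_natFloor hgs hi', hg, tsum_mul_left, smul_eq_mul, rescaledKernel,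
    discreteBesselKernel]
  field_simp

lemma exists_eventually_abs_edgeBessel_edgeNode_le {ι : Type*} {l : Filter ι} {A s : ι → ℝ}
    {s₀ : ℝ} (hA : Tendsto A l atTop) (hs : Tendsto s l (𝓝 s₀)) :
    ∃ C, 0 ≤ C ∧ ∀ᶠ i in l, ∀ u, 0 < u →
      |edgeBessel (edgeScale (A i)) (edgeNode (A i) (s i) u)| ≤ C / (1 + u) := by
  -- The `3` absorbs the drift of `s` below `s₀` (at most `1`) and the two floor errors (at most
  -- `1/κ ≤ 1` each).
  obtain ⟨C, hC, h⟩ := exists_abs_edgeBessel_le (by positivity : 0 ≤ |s₀| + 3)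
  refine ⟨C, hC, ?_⟩
  filter_upwards [hA.eventually_gt_atTop 0, (tendsto_edgeScale.comp hA).eventually_ge_atTop 1,
    hs.eventually_const_lt (sub_one_lt s₀)] with i hAi hκi hsi u hu
  have hκ1 : 1 / edgeScale (A i) ≤ 1 := (div_le_one (edgeScale_pos hAi)).2 hκi
  have h1 := (edgeNode_bounds hAi hu.le (s i)).1
  have h2 := neg_abs_le s₀
  refine (h _ (edgeScale_pos hAi) _ (by linarith)).trans ?_
  exact div_le_div_of_nonneg_left hC (by linarith) (by linarith)

lemma tendsto_rescaledKernel {ι : Type*} {l : Filter ι} [l.IsCountablyGenerated] {A s t : ι → ℝ}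
    {s₀ t₀ : ℝ} (hA : Tendsto A l atTop) (hs : Tendsto s l (𝓝 s₀)) (ht : Tendsto t l (𝓝 t₀)) :
    Tendsto (fun i => rescaledKernel (A i) (s i) (t i)) l (𝓝 (airyKernel s₀ t₀)) := by
  obtain ⟨C, hC, h⟩ := exists_eventually_abs_edgeBessel_edgeNode_le hA hs
  obtain ⟨C', hC', h'⟩ := exists_eventually_abs_edgeBessel_edgeNode_le hA ht
  have hmeas : ∀ i, AEStronglyMeasurable (fun u =>
      edgeBessel (edgeScale (A i)) (edgeNode (A i) (s i) u) *
      edgeBessel (edgeScale (A i)) (edgeNode (A i) (t i) u)) (volume.restrict (Ioi 0)) := fun i =>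
    ((measurable_edgeBessel_edgeNode _ _).mul
      (measurable_edgeBessel_edgeNode _ _)).aestronglyMeasurable
  have hbound : ∀ᶠ i in l, ∀ᵐ u ∂volume.restrict (Ioi 0),
      ‖edgeBessel (edgeScale (A i)) (edgeNode (A i) (s i) u) *
      edgeBessel (edgeScale (A i)) (edgeNode (A i) (t i) u)‖ ≤ C * C' / (1 + u) ^ 2 := by
    filter_upwards [h, h'] with i hi hi'
    exact (ae_restrict_iff' measurableSet_Ioi).2
      (ae_of_all _ fun u hu => norm_mul_le_div_one_add_sq hC hu (hi u hu) (hi' u hu))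
  have hlim := tendsto_integral_filter_of_dominated_convergence _
    (Eventually.of_forall hmeas) hbound (integrableOn_div_one_add_sq (C * C'))
    ((ae_restrict_iff' measurableSet_Ioi).2 (ae_of_all _ fun u hu =>
      (tendsto_edgeBessel_comp (tendsto_edgeScale.comp hA)
        (tendsto_edgeNode hA hs (le_of_lt hu))).mul
      (tendsto_edgeBessel_comp (tendsto_edgeScale.comp hA)
        (tendsto_edgeNode hA ht (le_of_lt hu)))))
  refine hlim.congr' ?_
  filter_upwards [hA.eventually_gt_atTop 0, hbound] with i hAi hbi
  exact (rescaledKernel_eq_integral hAi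
    ((integrableOn_div_one_add_sq (C * C')).mono' (hmeas i) hbi)).symm

theorem theorem1 :
    (∀ x : ℝ, Tendsto (airyTrunc x) atTop (𝓝 (airyAi x))) ∧
    (∀ (A : ℝ) (ν l : ℤ), 0 < A →
      Summable (fun r : ℕ => besselJ (ν + r) A * besselJ (l + r) A)) ∧
    (∀ s t : ℝ, IntegrableOn (fun u : ℝ => airyAi (s + u) * airyAi (t + u)) (Ioi 0)) ∧
    TendstoLocallyUniformly
      (fun (A : ℝ) (p : ℝ × ℝ) => rescaledKernel A p.1 p.2)
      (fun p : ℝ × ℝ => airyKernel p.1 p.2) atTop := by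
  refine ⟨tendsto_airyTrunc, fun A ν l hA => summable_besselJ_mul_besselJ hA ν l,
    integrableOn_airyAi_mul_airyAi, tendstoLocallyUniformly_of_tendsto_prod fun x => ?_⟩
  have h2 : Tendsto (fun q : ℝ × ℝ × ℝ => q.2) (atTop ×ˢ 𝓝 x) (𝓝 x) := tendsto_snd
  exact tendsto_rescaledKernel tendsto_fst ((continuous_fst.tendsto x).comp h2)
    ((continuous_snd.tendsto x).comp h2)
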